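/- **Conventions.** Let $L$ be a bounded distributive lattice. $L$ is *complete* if all subsets have suprema and infima; *compact* if every $A\subseteq L$ with $\sup A=1$ has a finite subset $B$ with $\sup B=1$; *subfit* if for all $a\neq b$ there is $c$ such that exactly one of $a\vee c$, $b\vee c$ equals $1$; *normal* if whenever $p\vee q=1$ (with $p\ne q$) there are $r,s$ with $r\wedge s=0$ and $r\vee p=s\vee q=1$. Sublattices are assumed to contain $0$ and $1$. A bounded lattice morphism $i:L\to M$ is *closed subfit* if whenever $i(p)\vee q=1$ there is $p'\in L$ with $p\vee p'=1$ and $i(p')\le q$. $\mathsf W(L)$ is the space of minimal prime filters of $L$, with topology generated by the sets $\mathcal N_p=\{F: p\in F\}$, $p\in L$. A *cozero set* of a space $X$ is the complement of $f^{-1}\{0\}$ for a continuous $f:X\to[0,1]$; the cozero sets form a bounded sublattice of the lattice of open sets. A *weak Stone–Čech compactification* of $X$ is a continuous map $\iota:X\to Y$ with dense range into a compact Hausdorff space $Y$ such that every continuous map from $X$ to a compact Hausdorff space factors uniquely as a continuous map on $Y$ composed with $\iota$. **Theorem.** Let $P$ be a complete, compact, subfit bounded distributive lattice, and let $Q$ be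 the lattice of cozero sets of $\mathsf W(P)$. There is a sublattice $S$ of $P$ which is normal, complete, compact and subfit, whose inclusion into $P$ is a closed subfit morphism, and which is the largest normal sublattice of $P$ in the following two senses: 1. $S$ contains every normal sublattice of $P$ whose inclusion into $P$ is a closed subfit morphism; 2. every normal subfit sublattice $R$ of $P$ (with no condition on its inclusion) embeds into $S$, by an injective closed subfit morphism $R\to S$. Moreover $S$ is the dual of the weak Stone–Čech compactification of $\mathsf W(P)$: the rule $$f(F)=\{U\in Q:\ F\in U \text{ and there is } V\in Q \text{ with } F\notin V,\ U\cup V=\mathsf W(P)\}$$ defines a continuous map $f:\mathsf W(P)\to\mathsf W(Q)$ which is a weak Stone–Čech compactification of $\mathsf W(P)$, and there is an order isomorphism $e$ from the lattice of open sets of $\mathsf W(Q)$ onto $S$ with $\mathcal N_{e(V)}=f^{-1}[V]$ for every open $V\subseteq\mathsf W(Q)$. -/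

import Mathlib

open Set Topology TopologicalSpace

universe u v

namespace WallmanDuality

section Lattices

variable (L : Type u) [DistribLattice L] [BoundedOrder L]

/-- Every subset has a supremum and an infimum. -/
def IsCompleteLat : Prop :=
  ∀ A : Set L, (∃ s, IsLUB A s) ∧ (∃ i, IsGLB A i)

/-- Whenever a subset has supremum `⊤`, already some finite part of it has supremum `⊤`. -/
def IsCompactLat : Prop :=
  ∀ A : Set L, IsLUB A ⊤ → ∃ B : Finset L, (B : Set L) ⊆ A ∧ IsLUB (B : Set L) ⊤

/-- Any two distinct elements are separated by an element which is joined to `⊤` by exactly one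
of them. -/
def IsSubfit : Prop :=
  ∀ a b : L, a ≠ b →
    ∃ c : L, (a ⊔ c = ⊤ ∧ b ⊔ c ≠ ⊤) ∨ (b ⊔ c = ⊤ ∧ a ⊔ c ≠ ⊤)

def IsNormalLat : Prop :=
  ∀ p q : L, p ≠ q → p ⊔ q = ⊤ → ∃ r s : L, r ⊓ s = ⊥ ∧ r ⊔ p = ⊤ ∧ s ⊔ q = ⊤

variable {L}

/-- Closed subfit morphisms of bounded distributive lattices. -/
def IsClosedSubfit {M : Type v} [DistribLattice M] [BoundedOrder M]
    (i : BoundedLatticeHom L M) : Prop :=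
  ∀ (p : L) (q : M), i p ⊔ q = ⊤ → ∃ p' : L, p ⊔ p' = ⊤ ∧ i p' ≤ q

end Lattices

section Sublattices

/-- Sublattices that contain the bottom and the top element of the ambient lattice. -/
structure BddSublattice (L : Type u) [DistribLattice L] [BoundedOrder L]
    extends Sublattice L where
  bot_mem : (⊥ : L) ∈ toSublattice
  top_mem : (⊤ : L) ∈ toSublattice

variable {L : Type u} [DistribLattice L] [BoundedOrder L]

instance : CoeSort (BddSublattice L) (Type u) := ⟨fun S => S.toSublattice⟩

instance (S : BddSublattice L) : BoundedOrder S where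
  top := ⟨⊤, S.top_mem⟩
  le_top a := (le_top : (a : L) ≤ ⊤)
  bot := ⟨⊥, S.bot_mem⟩
  bot_le a := (bot_le : ⊥ ≤ (a : L))

/-- The inclusion of a bounded sublattice, as a morphism of bounded lattices. -/
def BddSublattice.incl (S : BddSublattice L) : BoundedLatticeHom S L where
  toFun a := a
  map_sup' _ _ := rfl
  map_inf' _ _ := rfl
  map_top' := rfl
  map_bot' := rfl

end Sublattices

section Wallman

variable (L : Type u) [DistribLattice L] [BoundedOrder L]

/-- The set underlying the space `W(L)`: the minimal prime filters of `L`. (Mathlib's prime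
filters are proper.) -/
def W : Type u := {F : Order.PFilter L // Minimal Order.PFilter.IsPrime F}

variable {L}

/-- The basic set of all minimal prime filters that contain `p`. -/
def basicSet (p : L) : Set (W L) := {F | p ∈ F.1}

variable (L)

/-- The topology on `W(L)` generated by the basic sets. -/
instance : TopologicalSpace (W L) := generateFrom (range (basicSet (L := L)))

end Wallman

section Cozero

variable {X : Type u} [TopologicalSpace X]

/-- `C` is the zero set of a continuous function to `[0,1]`. -/
def IsZeroSet (C : Set X) : Prop :=
  ∃ f : X → unitInterval, Continuous f ∧ f ⁻¹' {0} = C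

def IsCozeroSet (U : Set X) : Prop := IsZeroSet Uᶜ

variable (X)

/-- The bounded distributive lattice of cozero sets, as a sublattice of the open sets. -/
def cozeroLattice : BddSublattice (Opens X) where
  carrier := {U | IsCozeroSet (U : Set X)}
  supClosed' := by
    rintro U ⟨f, hf, hU⟩ V ⟨g, hg, hV⟩
    refine ⟨fun x => max (f x) (g x), hf.max hg, ?_⟩
    ext x
    have h1 := congrArg (x ∈ ·) hU
    have h2 := congrArg (x ∈ ·) hV
    simp only [mem_preimage, mem_singleton_iff, mem_compl_iff, SetLike.mem_coe, eq_iff_iff] at h1 h2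
    simp only [mem_preimage, mem_singleton_iff, Opens.coe_sup, compl_union, mem_inter_iff,
      mem_compl_iff, SetLike.mem_coe, ← h1, ← h2]
    constructor
    · intro h
      exact ⟨le_antisymm (h ▸ le_max_left _ _) unitInterval.nonneg',
        le_antisymm (h ▸ le_max_right _ _) unitInterval.nonneg'⟩
    · rintro ⟨h, h'⟩
      rw [h, h', max_self]
  infClosed' := by
    rintro U ⟨f, hf, hU⟩ V ⟨g, hg, hV⟩
    refine ⟨fun x => min (f x) (g x), hf.min hg, ?_⟩
    ext x
    have h1 := congrArg (x ∈ ·) hU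
    have h2 := congrArg (x ∈ ·) hV
    simp only [mem_preimage, mem_singleton_iff, mem_compl_iff, SetLike.mem_coe, eq_iff_iff] at h1 h2
    simp only [mem_preimage, mem_singleton_iff, Opens.coe_inf, compl_inter, mem_union,
      mem_compl_iff, SetLike.mem_coe, ← h1, ← h2]
    constructor
    · intro h
      rcases min_choice (f x) (g x) with h' | h'
      · exact Or.inl (h' ▸ h)
      · exact Or.inr (h' ▸ h)
    · rintro (h | h)
      · rw [h]; exact min_eq_left unitInterval.nonneg'
      · rw [h]; exact min_eq_right unitInterval.nonneg'
  bot_mem := by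
    refine ⟨fun _ => 0, continuous_const, ?_⟩
    ext x
    simp
  top_mem := by
    refine ⟨fun _ => 1, continuous_const, ?_⟩
    ext x
    simp

end Cozero

/-- `ι : X → Y` is a weak Stone–Čech compactification of `X`: `Y` is compact Hausdorff, `ι` is
continuous with dense range, and continuous maps from `X` to compact Hausdorff spaces extend
uniquely along `ι`. -/
structure IsWeakStoneCech {X Y : Type u} [TopologicalSpace X] [TopologicalSpace Y]
    (ι : C(X, Y)) : Prop where
  compact : CompactSpace Y
  hausdorff : T2Space Y
  dense : DenseRange ι
  extend : ∀ (K : Type v) [TopologicalSpace K] [CompactSpace K] [T2Space K] (g : C(X, K)),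
    ∃! h : C(Y, K), h.comp ι = g

end WallmanDuality

open WallmanDuality

namespace WallmanDuality

/-! ### Minimal prime filters and the duality with compact spaces -/

section Points

variable {L : Type u} [DistribLattice L]

/-! `P` is the lattice of open sets of the compact space `W P`, so sublattices of `P` are lattices
of open sets there. A normal sublattice `R` has a compact Hausdorff space `W R`, and normality gives
a continuous map `W P → W R` with dense, hence full, range. Normal sublattices thus yield Hausdorff
quotients of `W P`, and the largest such quotient should yield the largest normal sublattice.

That quotient is `W Q`, with `Q` the normal lattice of cozero sets: `cozeroMap` identifies only
points which no map to a compact Hausdorff space separates (`eq_of_cozeroMap_eq`), so all such maps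
factor through it. `S` consists of the preimages of open sets of `W Q`.

For normal `R`, factor `W P → W R` through `h : W Q → W R`. If the inclusion is closed subfit, each
element of `R` is the preimage of its own basic set (`mem_restrictMap`), so `R` lies in `S`.
Otherwise the preimage can be smaller than the element, and pulling back along `h` gives only an
embedding; subfitness makes it injective. -/

theorem W.mono (F : W L) {a b : L} (h : a ≤ b) (ha : a ∈ F.1) : b ∈ F.1 :=
  Order.PFilter.mem_of_le h ha

theorem W.sup_mem_iff (F : W L) {a b : L} : a ⊔ b ∈ F.1 ↔ a ∈ F.1 ∨ b ∈ F.1 := by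
  constructor
  · intro h
    by_contra! hn
    have hI := F.2.1.compl_ideal
    exact Order.Ideal.sup_mem (s := hI.toIdeal) (x := a) (y := b) hn.1 hn.2 h
  · rintro (h | h)
    · exact F.mono le_sup_left h
    · exact F.mono le_sup_right h

theorem basicSet_sup (a b : L) : basicSet (a ⊔ b) = basicSet a ∪ basicSet b :=
  Set.ext fun F => F.sup_mem_iff

theorem basicSet_inf (a b : L) : basicSet (a ⊓ b) = basicSet a ∩ basicSet b :=
  Set.ext fun _ => Order.PFilter.inf_mem_iff

theorem isOpen_basicSet (a : L) : IsOpen (basicSet a) :=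
  isOpen_generateFrom_of_mem ⟨a, rfl⟩

variable [BoundedOrder L]

theorem W.bot_notMem (F : W L) : (⊥ : L) ∉ F.1 := by
  have h := F.2.1.compl_ideal
  obtain ⟨a, ha⟩ := h.Nonempty
  exact h.IsLowerSet bot_le ha

/-- By minimality: were there no such `b`, the complement of `F` and `a` would generate a proper
ideal, and a prime ideal above it would have as complement a prime filter strictly inside `F`. -/
theorem exists_notMem_sup_eq_top_of_mem (F : W L) {a : L} (ha : a ∈ F.1) :
    ∃ b ∉ F.1, a ⊔ b = ⊤ := by
  by_contra! hn
  have hI := F.2.1.compl_ideal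
  have hdisj : Disjoint ((Order.PFilter.principal (⊤ : L) : Order.PFilter L) : Set L)
      ((hI.toIdeal ⊔ Order.Ideal.principal a : Order.Ideal L) : Set L) := by
    rw [Set.disjoint_left]
    intro x hx hx'
    obtain ⟨j, hj, hxj⟩ := (Lattice.mem_ideal_sup_principal _ _ _).1 hx'
    have hx : ⊤ ≤ x := hx
    exact hn j hj (top_le_iff.1 ((hx.trans hxj).trans_eq (sup_comm _ _)))
  obtain ⟨J, hJ, hIJ, -⟩ := DistribLattice.prime_ideal_of_disjoint_filter_ideal hdisj
  have haJ : a ∈ J := hIJ (le_sup_right (a := hI.toIdeal) Order.Ideal.mem_principal_self)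
  have hle : F.1 ≤ hJ.toPrimePair.F := by
    refine F.2.2 hJ.toPrimePair.F_isPrime fun x hx => ?_
    by_contra hxF
    exact hx (hIJ (le_sup_left (a := hI.toIdeal) (b := Order.Ideal.principal a) hxF))
  exact hle ha haJ

theorem mem_iff_exists_sup_eq_top (F : W L) {a : L} :
    a ∈ F.1 ↔ ∃ b ∉ F.1, a ⊔ b = ⊤ := by
  refine ⟨exists_notMem_sup_eq_top_of_mem F, ?_⟩
  rintro ⟨b, hb, hab⟩
  refine (F.sup_mem_iff.1 ?_).resolve_right hb
  rw [hab]
  exact Order.PFilter.top_mem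

/-- The complement of an ideal that is maximal among the proper ones, as a point of `W(L)`. -/
def W.ofIdeal (J : Order.Ideal L) (htop : ⊤ ∉ J) (hmax : ∀ a ∉ J, ∃ b ∈ J, a ⊔ b = ⊤) : W L :=
  ⟨Order.IsPFilter.toPFilter (F := (J : Set L)ᶜ) (by
      refine Order.IsPFilter.of_def ⟨⊤, htop⟩ ?_ (fun hab ha hb => ha (J.lower hab hb))
      intro a ha b hb
      refine ⟨a ⊓ b, fun hab => ?_, inf_le_left, inf_le_right⟩
      obtain ⟨c, hc, hac⟩ := hmax a ha
      obtain ⟨d, hd, hbd⟩ := hmax b hb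
      refine htop ?_
      have : a ⊓ b ⊔ (c ⊔ d) = ⊤ := by
        rw [sup_inf_right, ← sup_assoc, hac, sup_left_comm, hbd]
        simp
      rw [← this]
      exact Order.Ideal.sup_mem hab (Order.Ideal.sup_mem hc hd)), by
    constructor
    · refine ⟨?_⟩
      change Order.IsIdeal ((J : Set L)ᶜᶜ)
      rw [compl_compl]
      exact J.isIdeal
    · intro G hG hGF a ha
      obtain ⟨b, hb, hab⟩ := hmax a ha
      by_contra haG
      have hI := hG.compl_ideal
      have hbG : b ∉ G := fun h => hGF h hb
      have := Order.Ideal.sup_mem (s := hI.toIdeal) (x := a) (y := b) haG hbG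
      rw [hab] at this
      exact this Order.PFilter.top_mem⟩

theorem W.mem_ofIdeal {J : Order.Ideal L} {htop : ⊤ ∉ J}
    {hmax : ∀ a ∉ J, ∃ b ∈ J, a ⊔ b = ⊤} {a : L} : a ∈ (W.ofIdeal J htop hmax).1 ↔ a ∉ J :=
  Iff.rfl

/-- Every proper ideal is disjoint from some minimal prime filter. -/
theorem exists_point_of_ideal (I : Order.Ideal L) (hI : ⊤ ∉ I) :
    ∃ F : W L, ∀ a ∈ I, a ∉ F.1 := by
  obtain ⟨J, hIJ, hJ⟩ := zorn_subset_nonempty {J : Set L | Order.IsIdeal J ∧ ⊤ ∉ J} (by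
    intro c hc hchain hne
    refine ⟨⋃₀ c, ⟨Order.isIdeal_sUnion_of_isChain (fun J hJ => (hc hJ).1) hchain hne, ?_⟩,
      fun J hJ => subset_sUnion_of_mem hJ⟩
    rintro ⟨J, hJ, h⟩
    exact (hc hJ).2 h) (I : Set L) ⟨I.isIdeal, hI⟩
  refine ⟨W.ofIdeal hJ.prop.1.toIdeal hJ.prop.2 fun a ha => ?_, fun a ha h => h (hIJ ha)⟩
  by_contra! hn
  have hle := hJ.le_of_ge (y := ((hJ.prop.1.toIdeal ⊔ Order.Ideal.principal a : Order.Ideal L) :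
      Set L)) ⟨Order.Ideal.isIdeal _, fun h => by
    obtain ⟨j, hj, hxj⟩ := (Lattice.mem_ideal_sup_principal _ _ _).1 h
    exact hn j hj (top_le_iff.1 (hxj.trans_eq (sup_comm _ _)))⟩
    (le_sup_left (a := hJ.prop.1.toIdeal) (b := Order.Ideal.principal a))
  exact ha (hle (le_sup_right (a := hJ.prop.1.toIdeal) Order.Ideal.mem_principal_self))

theorem exists_point_notMem {a : L} (ha : a ≠ ⊤) : ∃ F : W L, a ∉ F.1 := by
  obtain ⟨F, hF⟩ := exists_point_of_ideal (Order.Ideal.principal a)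
    (fun h => ha (top_le_iff.1 h))
  exact ⟨F, hF a le_rfl⟩

theorem basicSet_top : basicSet (⊤ : L) = univ :=
  eq_univ_of_forall fun _ => Order.PFilter.top_mem

theorem basicSet_bot : basicSet (⊥ : L) = ∅ :=
  eq_empty_of_forall_notMem fun F => F.bot_notMem

theorem basicSet_eq_univ_iff {a : L} : basicSet a = univ ↔ a = ⊤ := by
  refine ⟨fun h => ?_, fun h => h ▸ basicSet_top⟩
  by_contra hn
  obtain ⟨F, hF⟩ := exists_point_notMem hn
  exact hF (h.symm ▸ mem_univ F : F ∈ basicSet a)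

theorem isTopologicalBasis_basicSet : IsTopologicalBasis (range (basicSet (L := L))) where
  exists_subset_inter := by
    rintro _ ⟨a, rfl⟩ _ ⟨b, rfl⟩ F hF
    exact ⟨_, ⟨a ⊓ b, rfl⟩, by rwa [basicSet_inf], (basicSet_inf a b).subset⟩
  sUnion_eq := eq_univ_of_forall fun F => ⟨_, ⟨⊤, rfl⟩, by rw [basicSet_top]; trivial⟩
  eq_generateFrom := rfl

/-- Otherwise the finite joins from `A` generate a proper ideal, and some point avoids all of it. -/
theorem exists_finset_of_cover (A : Set L) (h : ∀ F : W L, ∃ a ∈ A, a ∈ F.1) :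
    ∃ B : Finset L, (B : Set L) ⊆ A ∧ B.sup id = ⊤ := by
  classical
  by_contra! hn
  let I : Order.Ideal L := Order.IsIdeal.toIdeal
    (I := {c | ∃ B : Finset L, (B : Set L) ⊆ A ∧ c ≤ B.sup id}) (by
      refine ⟨fun a b hba ⟨B, hB, ha⟩ => ⟨B, hB, hba.trans ha⟩,
        ⟨⊥, ∅, by simp, bot_le⟩, ?_⟩
      rintro a ⟨B, hB, ha⟩ b ⟨C, hC, hb⟩
      refine ⟨a ⊔ b, ⟨B ∪ C, by simp [hB, hC], ?_⟩, le_sup_left, le_sup_right⟩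
      rw [Finset.sup_union]
      exact sup_le_sup ha hb)
  obtain ⟨F, hF⟩ := exists_point_of_ideal I fun ⟨B, hB, h⟩ => hn B hB (top_le_iff.1 h)
  obtain ⟨a, haA, ha⟩ := h F
  exact hF a ⟨{a}, by simpa using haA, by simp⟩ ha

theorem W.finset_sup_mem (F : W L) (B : Finset L) : B.sup id ∈ F.1 ↔ ∃ b ∈ B, b ∈ F.1 := by
  classical
  induction B using Finset.induction_on with
  | empty => simpa using F.bot_notMem
  | insert a B ha ih => simp [F.sup_mem_iff, ih]

instance : CompactSpace (W L) := by
  refine compactSpace_generateFrom rfl fun P hP hcov => ?_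
  obtain ⟨B, hB, htop⟩ := exists_finset_of_cover {a : L | basicSet a ∈ P} fun F => by
    obtain ⟨s, hs, hF⟩ : F ∈ ⋃₀ P := hcov ▸ mem_univ F
    obtain ⟨a, rfl⟩ := hP hs
    exact ⟨a, hs, hF⟩
  refine ⟨basicSet '' (B : Set L), image_subset_iff.2 hB, B.finite_toSet.image _,
    eq_univ_of_forall fun F => ?_⟩
  obtain ⟨b, hb, hbF⟩ := (F.finset_sup_mem B).1 (htop ▸ Order.PFilter.top_mem)
  exact ⟨_, ⟨b, hb, rfl⟩, hbF⟩

theorem IsNormalLat.exists_disjoint (hL : IsNormalLat L) {p q : L} (h : p ⊔ q = ⊤) :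
    ∃ r s : L, r ⊓ s = ⊥ ∧ r ⊔ p = ⊤ ∧ s ⊔ q = ⊤ := by
  by_cases hpq : p = q
  · subst hpq
    rw [sup_idem] at h
    exact ⟨⊥, ⊥, by simp, by simp [h], by simp [h]⟩
  · exact hL p q hpq h

theorem IsNormalLat.t2Space (hL : IsNormalLat L) : T2Space (W L) := by
  refine ⟨fun F G hFG => ?_⟩
  obtain ⟨a, haF, haG⟩ : ∃ a, a ∈ F.1 ∧ a ∉ G.1 := by
    by_contra! hn
    exact hFG (Subtype.ext (le_antisymm hn (G.2.2 F.2.1 hn)))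
  obtain ⟨b, hb, hab⟩ := exists_notMem_sup_eq_top_of_mem F haF
  obtain ⟨r, s, hrs, hra, hsb⟩ := hL.exists_disjoint hab
  refine ⟨_, _, isOpen_basicSet s, isOpen_basicSet r, ?_, ?_, ?_⟩
  · exact (mem_iff_exists_sup_eq_top F).2 ⟨b, hb, hsb⟩
  · exact (mem_iff_exists_sup_eq_top G).2 ⟨a, haG, hra⟩
  · rw [Set.disjoint_iff_inter_eq_empty, ← basicSet_inf, inf_comm, hrs, basicSet_bot]

theorem IsSubfit.basicSet_injective (hL : IsSubfit L) :
    Function.Injective (basicSet (L := L)) := by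
  intro a b hab
  by_contra hne
  obtain ⟨c, h⟩ := hL a b hne
  have key : a ⊔ c = ⊤ ↔ b ⊔ c = ⊤ := by
    rw [← basicSet_eq_univ_iff, ← basicSet_eq_univ_iff, basicSet_sup, basicSet_sup, hab]
  tauto

/-- Basic sets, as a morphism into the lattice of open sets. -/
def basicHom (L : Type u) [DistribLattice L] [BoundedOrder L] :
    BoundedLatticeHom L (Opens (W L)) where
  toFun a := ⟨basicSet a, isOpen_basicSet a⟩
  map_sup' a b := Opens.ext (basicSet_sup a b)
  map_inf' a b := Opens.ext (basicSet_inf a b)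
  map_top' := Opens.ext basicSet_top
  map_bot' := Opens.ext basicSet_bot

/-- Infinite joins need not become unions in general; compactness of `L` forces it. If `s ∈ F` is
completed by `b ∉ F`, then `b` and finitely many elements below `s` already join to `⊤`, so one of
the latter lies in `F`. -/
theorem basicHom_surjective (h : IsCompleteLat L) (hc : IsCompactLat L) :
    Function.Surjective (basicHom L) := by
  classical
  intro O
  obtain ⟨s, hs⟩ := (h {a : L | basicSet a ⊆ O}).1
  refine ⟨s, Opens.ext (Subset.antisymm ?_ ?_)⟩
  · intro F (hF : s ∈ F.1)
    obtain ⟨b, hb, hsb⟩ := exists_notMem_sup_eq_top_of_mem F hF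
    obtain ⟨B, hB, hBtop⟩ := hc (insert b {a : L | basicSet a ⊆ O}) (by
      refine ⟨fun _ _ => le_top, fun c hcu => ?_⟩
      rw [← hsb]
      exact sup_le (hs.2 fun a ha => hcu (Or.inr ha)) (hcu (Or.inl rfl)))
    have hBF : B.sup id ∈ F.1 := by
      rw [(Finset.isLUB_sup_id (s := B)).unique hBtop]
      exact Order.PFilter.top_mem
    obtain ⟨a, haB, haF⟩ := (F.finset_sup_mem B).1 hBF
    rcases hB haB with rfl | haO
    · exact absurd haF hb
    · exact haO haF
  · intro F hF
    obtain ⟨_, ⟨a, rfl⟩, haF, haO⟩ :=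
      isTopologicalBasis_basicSet.exists_subset_of_mem_open hF O.isOpen
    exact F.mono (hs.1 haO) haF

/-- A complete, compact, subfit lattice is the lattice of open sets of its space of minimal prime
filters. -/
noncomputable def opensIso (h : IsCompleteLat L) (hc : IsCompactLat L) (hs : IsSubfit L) :
    L ≃o Opens (W L) where
  toEquiv := Equiv.ofBijective (basicHom L)
    ⟨fun _ _ hab => hs.basicSet_injective (congrArg SetLike.coe hab), basicHom_surjective h hc⟩
  map_rel_iff' {a b} := by
    have hinj : Function.Injective (basicHom L) :=
      fun _ _ hab => hs.basicSet_injective (congrArg SetLike.coe hab)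
    change basicHom L a ≤ basicHom L b ↔ a ≤ b
    rw [← inf_eq_left, ← map_inf, hinj.eq_iff, inf_eq_left]

end Points

/-! ### Lattices of open sets -/

section OpensLattice

theorem isCompleteLat_of_orderIso {M : Type*} [CompleteLattice M] {L : Type u} [DistribLattice L]
    (e : M ≃o L) : IsCompleteLat L := by
  intro A
  refine ⟨⟨e (sSup (e.symm '' A)), ?_⟩, ⟨e (sInf (e.symm '' A)), ?_⟩⟩
  · rw [← e.symm.isLUB_image']
    simpa using isLUB_sSup (e.symm '' A)
  · rw [← e.symm.isGLB_image']
    simpa using isGLB_sInf (e.symm '' A)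

variable {Y : Type*} [TopologicalSpace Y] {L : Type u} [DistribLattice L] [BoundedOrder L]

theorem isCompactLat_of_opens_orderIso [CompactSpace Y] (e : Opens Y ≃o L) : IsCompactLat L := by
  classical
  intro A hA
  have hsup : sSup (e.symm '' A) = ⊤ := by
    have := e.symm.isLUB_image'.2 hA
    rw [map_top] at this
    exact this.sSup_eq
  obtain ⟨t, ht⟩ := isCompact_univ.elim_finite_subcover (fun a : A => (e.symm a : Set Y))
    (fun a => (e.symm a).isOpen) (fun y _ => by
      have hy : y ∈ sSup (e.symm '' A) := hsup ▸ trivial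
      obtain ⟨_, ⟨a, ha, rfl⟩, hya⟩ := Opens.mem_sSup.1 hy
      exact mem_iUnion.2 ⟨⟨a, ha⟩, hya⟩)
  refine ⟨t.image Subtype.val, by simp, fun _ _ => le_top, fun c hc => ?_⟩
  rw [← e.symm.le_iff_le]
  intro y _
  obtain ⟨a, ha, hya⟩ := mem_iUnion₂.1 (ht (mem_univ y))
  exact e.symm.monotone (hc (by simpa using ha)) hya

theorem isSubfit_of_opens_orderIso [T1Space Y] (e : Opens Y ≃o L) : IsSubfit L := by
  have key : ∀ a b : L, ¬ a ≤ b → ∃ c, a ⊔ c = ⊤ ∧ b ⊔ c ≠ ⊤ := by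
    intro a b hab
    rw [← e.symm.le_iff_le, ← SetLike.coe_subset_coe, not_subset] at hab
    obtain ⟨y, hya, hyb⟩ := hab
    let C : Opens Y := ⟨{y}ᶜ, isOpen_compl_singleton⟩
    refine ⟨e C, e.symm.injective ?_, fun h => ?_⟩
    · rw [map_sup, e.symm_apply_apply, map_top]
      refine Opens.ext (eq_univ_of_forall fun z => ?_)
      by_cases hz : z = y
      · exact Or.inl (hz ▸ hya)
      · exact Or.inr hz
    · have h := congrArg e.symm h
      rw [map_sup, e.symm_apply_apply, map_top] at h
      have hy : y ∈ e.symm b ⊔ C := h ▸ trivial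
      rcases hy with hy | hy
      · exact hyb hy
      · exact hy rfl
  intro a b hab
  by_cases h : a ≤ b
  · obtain ⟨c, hc⟩ := key b a fun h' => hab (le_antisymm h h')
    exact ⟨c, Or.inr hc⟩
  · obtain ⟨c, hc⟩ := key a b h
    exact ⟨c, Or.inl hc⟩

theorem isNormalLat_of_opens_orderIso [NormalSpace Y] (e : Opens Y ≃o L) : IsNormalLat L := by
  intro p q _ hpq
  have hpq := congrArg e.symm hpq
  rw [map_sup, map_top] at hpq
  have hdisj : Disjoint ((e.symm p : Set Y)ᶜ) ((e.symm q : Set Y)ᶜ) := by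
    rw [Set.disjoint_iff_inter_eq_empty, ← compl_union, compl_empty_iff]
    exact congrArg SetLike.coe hpq
  obtain ⟨R, S, hR, hS, hpR, hqS, hRS⟩ := normal_separation (e.symm p).isOpen.isClosed_compl
    (e.symm q).isOpen.isClosed_compl hdisj
  refine ⟨e ⟨R, hR⟩, e ⟨S, hS⟩, ?_, ?_, ?_⟩
  · rw [← map_inf, ← map_bot e]
    exact congrArg e (Opens.ext hRS.inter_eq)
  · apply e.symm.injective
    rw [map_sup, e.symm_apply_apply, map_top]
    exact Opens.ext (compl_subset_iff_union.1 (compl_subset_comm.1 hpR) |>.trans rfl)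
  · apply e.symm.injective
    rw [map_sup, e.symm_apply_apply, map_top]
    exact Opens.ext (compl_subset_iff_union.1 (compl_subset_comm.1 hqS) |>.trans rfl)

end OpensLattice

/-! ### The canonical map to the space of a normal lattice -/

section WallmanMap

variable {L : Type u} [DistribLattice L] [BoundedOrder L] {X : Type*} [TopologicalSpace X]

/-- The ideal of elements `a` that are never completed to `⊤` by an element `b` whose image
misses `x`. -/
def idealAt (hL : IsNormalLat L) (i : BoundedLatticeHom L (Opens X)) (x : X) : Order.Ideal L :=
  Order.IsIdeal.toIdeal (I := {a | ∀ b, x ∉ i b → a ⊔ b ≠ ⊤}) (by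
    refine ⟨fun a b hba ha c hc h => ha c hc (top_le_iff.1 (h ▸ sup_le_sup_right hba c)),
      ⟨⊥, fun b hb h => hb ?_⟩, fun a ha b hb => ⟨a ⊔ b, fun c hc h => ?_, le_sup_left,
        le_sup_right⟩⟩
    · rw [bot_sup_eq] at h
      rw [h, map_top]
      trivial
    · rw [sup_assoc] at h
      -- Since `a` is in the ideal, `x` lies in `i r`, hence not in the disjoint `i s`; so `c ⊔ s`
      -- still misses `x` and completes `b`.
      obtain ⟨r, s, hrs, hra, hsb⟩ := hL.exists_disjoint h
      rw [sup_comm] at hra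
      have hxr : x ∈ i r := by
        by_contra hxr
        exact ha r hxr hra
      refine hb (c ⊔ s) ?_ (by rw [← hsb, sup_comm s, sup_assoc])
      rw [map_sup]
      rintro (hx | hx)
      · exact hc hx
      · have : x ∈ i (r ⊓ s) := by
          rw [map_inf]
          exact ⟨hxr, hx⟩
        rw [hrs, map_bot] at this
        exact this)

theorem mem_idealAt {hL : IsNormalLat L} {i : BoundedLatticeHom L (Opens X)} {x : X} {a : L} :
    a ∈ idealAt hL i x ↔ ∀ b, x ∉ i b → a ⊔ b ≠ ⊤ := Iff.rfl

/-- The canonical map from `X` to the minimal prime filters of a normal lattice that is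
represented by open subsets of `X`. -/
def wallmanPoint (hL : IsNormalLat L) (i : BoundedLatticeHom L (Opens X)) (x : X) : W L :=
  W.ofIdeal (idealAt hL i x)
    (fun h => mem_idealAt.1 h ⊥ (by rw [map_bot]; exact id) (by simp))
    (fun a ha => by
      rw [mem_idealAt] at ha
      push Not at ha
      obtain ⟨b, hb, hab⟩ := ha
      refine ⟨b, mem_idealAt.2 fun c hc hbc => ?_, hab⟩
      have : x ∈ i (b ⊔ c) := by
        rw [hbc, map_top]
        trivial
      rw [map_sup] at this
      exact this.elim hb hc)

theorem mem_wallmanPoint {hL : IsNormalLat L} {i : BoundedLatticeHom L (Opens X)} {x : X}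
    {a : L} : a ∈ (wallmanPoint hL i x).1 ↔ ∃ b, x ∉ i b ∧ a ⊔ b = ⊤ := by
  rw [wallmanPoint, W.mem_ofIdeal, mem_idealAt]
  push Not
  rfl

theorem mem_of_mem_wallmanPoint {hL : IsNormalLat L} {i : BoundedLatticeHom L (Opens X)} {x : X}
    {a : L} (h : a ∈ (wallmanPoint hL i x).1) : x ∈ i a := by
  obtain ⟨b, hb, hab⟩ := mem_wallmanPoint.1 h
  have : x ∈ i (a ⊔ b) := by
    rw [hab, map_top]
    trivial
  rw [map_sup] at this
  exact this.resolve_right hb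

theorem continuous_wallmanPoint (hL : IsNormalLat L) (i : BoundedLatticeHom L (Opens X)) :
    Continuous (wallmanPoint hL i) := by
  refine continuous_generateFrom_iff.2 ?_
  rintro _ ⟨a, rfl⟩
  rw [isOpen_iff_forall_mem_open]
  intro x hx
  obtain ⟨b, hb, hab⟩ := mem_wallmanPoint.1 hx
  obtain ⟨r, s, hrs, hra, hsb⟩ := hL.exists_disjoint hab
  -- On the neighbourhood `i s` of `x` the single element `r`, disjoint from `s`, completes `a`.
  refine ⟨i s, fun y hy => mem_wallmanPoint.2 ⟨r, fun hyr => ?_, by rw [sup_comm, hra]⟩,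
    (i s).isOpen, ?_⟩
  · have : y ∈ i (r ⊓ s) := by
      rw [map_inf]
      exact ⟨hyr, hy⟩
    rw [hrs, map_bot] at this
    exact this
  · exact mem_of_mem_wallmanPoint (hL := hL) (mem_wallmanPoint.2 ⟨b, hb, hsb⟩)

/-- `wallmanPoint` as a continuous map. -/
def wallmanMap (hL : IsNormalLat L) (i : BoundedLatticeHom L (Opens X)) : C(X, W L) :=
  ⟨wallmanPoint hL i, continuous_wallmanPoint hL i⟩

theorem mem_wallmanMap {hL : IsNormalLat L} {i : BoundedLatticeHom L (Opens X)} {x : X}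
    {a : L} : a ∈ (wallmanMap hL i x).1 ↔ ∃ b, x ∉ i b ∧ a ⊔ b = ⊤ :=
  mem_wallmanPoint

theorem denseRange_wallmanMap (hL : IsNormalLat L) {i : BoundedLatticeHom L (Opens X)}
    (hi : ∀ b, i b = ⊤ → b = ⊤) : DenseRange (wallmanMap hL i) := by
  refine isTopologicalBasis_basicSet.dense_iff.2 ?_
  rintro _ ⟨a, rfl⟩ ⟨F, hF⟩
  obtain ⟨b, hb, hab⟩ := exists_notMem_sup_eq_top_of_mem F hF
  obtain ⟨x, hx⟩ : ∃ x, x ∉ i b := by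
    by_contra! hn
    exact hb ((hi b (Opens.ext (eq_univ_of_forall hn))) ▸ Order.PFilter.top_mem)
  exact ⟨_, mem_wallmanMap.2 ⟨b, hx, hab⟩, x, rfl⟩

/-- The dense range is compact in a Hausdorff space, hence closed. -/
theorem surjective_wallmanMap [CompactSpace X] (hL : IsNormalLat L)
    {i : BoundedLatticeHom L (Opens X)} (hi : ∀ b, i b = ⊤ → b = ⊤) :
    Function.Surjective (wallmanMap hL i) := by
  have := hL.t2Space
  rw [← range_eq_univ, ← (denseRange_wallmanMap hL hi).closure_range]
  exact (isCompact_range (wallmanMap hL i).continuous).isClosed.closure_eq.symm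

end WallmanMap

/-! ### Cozero sets and the weak Stone–Čech compactification -/

section Cozero

variable {X : Type u} [TopologicalSpace X]

theorem isCozeroSet_pos {φ : X → ℝ} (hφ : Continuous φ) : IsCozeroSet {x | 0 < φ x} := by
  refine ⟨fun x => projIcc 0 1 zero_le_one (φ x), continuous_projIcc.comp hφ, ?_⟩
  ext x
  have : (projIcc (0 : ℝ) 1 zero_le_one (φ x) = 0) ↔ φ x ≤ 0 := projIcc_eq_left zero_lt_one
  simp [this]

theorem IsCozeroSet.exists_real {U : Set X} (hU : IsCozeroSet U) :
    ∃ φ : X → ℝ, Continuous φ ∧ (∀ x, 0 ≤ φ x) ∧ ∀ x, x ∈ U ↔ 0 < φ x := by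
  obtain ⟨f, hf, h⟩ := hU
  refine ⟨fun x => f x, by fun_prop, fun x => (f x).2.1, fun x => ?_⟩
  have h := congrArg (x ∈ ·) h
  simp only [mem_preimage, mem_singleton_iff, mem_compl_iff, eq_iff_iff] at h
  rw [← not_iff_not, ← h, not_lt]
  exact ⟨fun h => (congrArg Subtype.val h).le, fun h => Subtype.ext (le_antisymm h (f x).2.1)⟩

/-- The set where a continuous function is positive, as an element of the cozero lattice. -/
def posSet (φ : X → ℝ) (hφ : Continuous φ) : cozeroLattice X :=
  ⟨⟨{x | 0 < φ x}, isOpen_lt continuous_const hφ⟩, isCozeroSet_pos hφ⟩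

theorem mem_posSet {φ : X → ℝ} {hφ : Continuous φ} {x : X} : x ∈ (posSet φ hφ).1 ↔ 0 < φ x :=
  Iff.rfl

theorem cozeroLattice_ext {U V : cozeroLattice X} (h : ∀ x, x ∈ U.1 ↔ x ∈ V.1) : U = V :=
  Subtype.ext (SetLike.ext h)

theorem cozeroLattice_sup_eq_top {U V : cozeroLattice X} :
    U ⊔ V = ⊤ ↔ ∀ x, x ∈ U.1 ∨ x ∈ V.1 := by
  refine ⟨fun h x => ?_, fun h => cozeroLattice_ext fun x => ⟨fun _ => trivial, fun _ => h x⟩⟩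
  have : x ∈ (U ⊔ V).1 := h ▸ trivial
  exact this

theorem isNormalLat_cozeroLattice : IsNormalLat (cozeroLattice X) := by
  intro U V _ hUV
  rw [cozeroLattice_sup_eq_top] at hUV
  obtain ⟨u, hu, hu0, hU⟩ := IsCozeroSet.exists_real U.2
  obtain ⟨v, hv, hv0, hV⟩ := IsCozeroSet.exists_real V.2
  change ∀ x, x ∈ U.1 ↔ _ at hU
  change ∀ x, x ∈ V.1 ↔ _ at hV
  simp only [hU, hV] at hUV
  -- The sets `u < v` and `v < u` are disjoint; where `u` vanishes `v` is positive, and conversely.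
  refine ⟨posSet (fun x => v x - u x) (by fun_prop), posSet (fun x => u x - v x) (by fun_prop),
    cozeroLattice_ext fun x => ⟨fun h => ?_, fun h => h.elim⟩, ?_, ?_⟩
  · have h1 : 0 < v x - u x := h.1
    have h2 : 0 < u x - v x := h.2
    linarith
  · refine cozeroLattice_sup_eq_top.2 fun x => ?_
    rw [mem_posSet, hU]
    rcases (hu0 x).lt_or_eq with h | h
    · exact Or.inr h
    · exact Or.inl (by linarith [(hUV x).resolve_left (by linarith)])
  · refine cozeroLattice_sup_eq_top.2 fun x => ?_
    rw [mem_posSet, hV]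
    rcases (hv0 x).lt_or_eq with h | h
    · exact Or.inr h
    · exact Or.inl (by linarith [(hUV x).resolve_right (by linarith)])

variable (X) in
/-- The canonical map from a space to the minimal prime filters of its cozero sets. -/
def cozeroMap : C(X, W (cozeroLattice X)) :=
  wallmanMap isNormalLat_cozeroLattice (cozeroLattice X).incl

theorem mem_cozeroMap {x : X} {U : cozeroLattice X} :
    U ∈ (cozeroMap X x).1 ↔ ∃ V : cozeroLattice X, x ∉ V.1 ∧ U ⊔ V = ⊤ :=
  mem_wallmanMap

theorem mem_of_mem_cozeroMap {x : X} {U : cozeroLattice X} (h : U ∈ (cozeroMap X x).1) :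
    x ∈ U.1 :=
  mem_of_mem_wallmanPoint h

theorem incl_eq_top {L : Type u} [DistribLattice L] [BoundedOrder L] (R : BddSublattice L)
    (b : R) (h : R.incl b = ⊤) : b = ⊤ :=
  Subtype.ext h

theorem surjective_cozeroMap [CompactSpace X] : Function.Surjective (cozeroMap X) :=
  surjective_wallmanMap _ (incl_eq_top _)

theorem eq_of_cozeroMap_eq {K : Type*} [TopologicalSpace K] [CompactSpace K] [T2Space K]
    (g : C(X, K)) {x y : X} (h : cozeroMap X x = cozeroMap X y) : g x = g y := by
  by_contra hne
  obtain ⟨φ, hφ0, hφ1, -⟩ := exists_continuous_zero_one_of_isClosed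
    (isClosed_singleton (x := g y)) (isClosed_singleton (x := g x))
    (disjoint_singleton.2 (Ne.symm hne))
  have h0 : φ (g y) = 0 := hφ0 rfl
  have h1 : φ (g x) = 1 := hφ1 rfl
  -- The ranges `φ > 1/4` and `φ < 1/2` overlap, so `U` and `V` cover `X`, while `V` misses `x` and
  -- `U` misses `y`.
  let U := posSet (fun z => φ (g z) - 1 / 4) (by fun_prop)
  let V := posSet (fun z => 1 / 2 - φ (g z)) (by fun_prop)
  have hU : U ∈ (cozeroMap X x).1 := by
    refine mem_cozeroMap.2 ⟨V, ?_, cozeroLattice_sup_eq_top.2 fun z => ?_⟩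
    · rw [mem_posSet, h1]
      norm_num
    · rw [mem_posSet, mem_posSet]
      by_contra! hn
      linarith [hn.1, hn.2]
  rw [h] at hU
  have := mem_posSet.1 (mem_of_mem_cozeroMap hU)
  rw [h0] at this
  norm_num at this

theorem exists_comp_cozeroMap_eq [CompactSpace X] {K : Type*} [TopologicalSpace K]
    [CompactSpace K] [T2Space K] (g : C(X, K)) :
    ∃ h : C(W (cozeroLattice X), K), h.comp (cozeroMap X) = g := by
  have := (isNormalLat_cozeroLattice (X := X)).t2Space
  have hq : IsQuotientMap (cozeroMap X) :=
    (cozeroMap X).continuous.isClosedMap.isQuotientMap (cozeroMap X).continuous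
      surjective_cozeroMap
  exact ⟨hq.lift g fun x y h => eq_of_cozeroMap_eq g h, hq.lift_comp g _⟩

theorem isWeakStoneCech_cozeroMap [CompactSpace X] : IsWeakStoneCech.{u, v} (cozeroMap X) where
  compact := inferInstance
  hausdorff := isNormalLat_cozeroLattice.t2Space
  dense := surjective_cozeroMap.denseRange
  extend K _ _ _ g := by
    obtain ⟨h, hh⟩ := exists_comp_cozeroMap_eq g
    refine ⟨h, hh, fun h' hh' => ContinuousMap.ext fun y => ?_⟩
    obtain ⟨x, rfl⟩ := surjective_cozeroMap y
    exact congrArg (fun k : C(X, K) => k x) (hh'.trans hh.symm)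

end Cozero
-- Sublattices pulled back from a Hausdorff image
section PullbackSublattice

variable {P : Type u} [DistribLattice P] [BoundedOrder P] {X Y : Type u} [TopologicalSpace X]
  [TopologicalSpace Y]

/-- The elements of `P ≃o Opens X` that correspond to preimages of open sets of `Y`. -/
def pullbackSublattice (E : P ≃o Opens X) (f : C(X, Y)) : BddSublattice P where
  carrier := {p | ∃ V : Opens Y, E p = Opens.comap f V}
  supClosed' := by
    rintro p ⟨V, hV⟩ q ⟨V', hV'⟩
    exact ⟨V ⊔ V', by rw [map_sup, map_sup, hV, hV']⟩
  infClosed' := by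
    rintro p ⟨V, hV⟩ q ⟨V', hV'⟩
    exact ⟨V ⊓ V', by rw [map_inf, map_inf, hV, hV']⟩
  bot_mem := ⟨⊥, by rw [map_bot, map_bot]⟩
  top_mem := ⟨⊤, by rw [map_top, map_top]⟩

theorem comap_le_comap_iff {f : C(X, Y)} (hf : Function.Surjective f) {V V' : Opens Y} :
    Opens.comap f V ≤ Opens.comap f V' ↔ V ≤ V' :=
  hf.preimage_subset_preimage_iff

/-- For surjective `f`, the open sets of `Y` form the pullback sublattice. -/
noncomputable def pullbackIso (E : P ≃o Opens X) {f : C(X, Y)} (hf : Function.Surjective f) :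
    Opens Y ≃o pullbackSublattice E f where
  toEquiv := Equiv.ofBijective
    (fun V => ⟨E.symm (Opens.comap f V), V, E.apply_symm_apply _⟩) (by
      constructor
      · intro V V' h
        have h := E.symm.injective (congrArg Subtype.val h)
        exact le_antisymm ((comap_le_comap_iff hf).1 h.le) ((comap_le_comap_iff hf).1 h.ge)
      · rintro ⟨p, V, hV⟩
        exact ⟨V, Subtype.ext (E.symm_apply_eq.2 hV.symm)⟩)
  map_rel_iff' {V V'} := by
    change E.symm (Opens.comap f V) ≤ E.symm (Opens.comap f V') ↔ V ≤ V'
    rw [E.symm.le_iff_le, comap_le_comap_iff hf]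

theorem apply_pullbackIso (E : P ≃o Opens X) {f : C(X, Y)} (hf : Function.Surjective f)
    (V : Opens Y) : E (pullbackIso E hf V : P) = Opens.comap f V :=
  E.apply_symm_apply _

theorem isClosedSubfit_incl_pullbackSublattice [CompactSpace X] [T2Space Y] (E : P ≃o Opens X)
    (f : C(X, Y)) : IsClosedSubfit (pullbackSublattice E f).incl := by
  rintro ⟨p, V, hV⟩ q hpq
  have hpq : E p ⊔ E q = ⊤ := by
    rw [← map_sup, ← map_top E]
    exact congrArg E hpq
  -- `C` is the set of points whose whole fibre lies in `E q`; it is open because `f` maps closed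
  -- sets to closed sets.
  let C : Opens Y := ⟨(f '' ((E q : Set X)ᶜ))ᶜ,
    (((E q).isOpen.isClosed_compl.isCompact).image f.continuous).isClosed.isOpen_compl⟩
  have hp' : E (E.symm (Opens.comap f C)) = Opens.comap f C := E.apply_symm_apply _
  refine ⟨⟨E.symm (Opens.comap f C), C, hp'⟩, Subtype.ext (E.injective ?_), ?_⟩
  · change E (p ⊔ E.symm (Opens.comap f C)) = E ⊤
    rw [map_sup, hp', hV, map_top]
    refine Opens.ext (eq_univ_of_forall fun x => ?_)
    by_cases hx : f x ∈ C
    · exact Or.inr hx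
    · left
      obtain ⟨y, hy, hyx⟩ := not_not.1 hx
      have hy' : y ∈ E p ⊔ E q := hpq ▸ trivial
      have hyp : y ∈ E p := hy'.resolve_right hy
      rw [hV] at hyp
      change f x ∈ V
      rw [← hyx]
      exact hyp
  · change E.symm (Opens.comap f C) ≤ q
    rw [← E.le_iff_le, hp']
    intro x hx
    by_contra hxq
    exact hx ⟨x, hxq, rfl⟩

end PullbackSublattice

/-! ### Quotients defined by normal sublattices -/

section NormalSublattice

variable {P : Type u} [DistribLattice P] [BoundedOrder P]

/-- The canonical map from the minimal prime filters of a lattice to those of a normal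
sublattice. -/
def restrictMap (R : BddSublattice P) (hR : IsNormalLat R) : C(W P, W R) :=
  wallmanMap hR ((basicHom P).comp R.incl)

theorem surjective_restrictMap (R : BddSublattice P) (hR : IsNormalLat R) :
    Function.Surjective (restrictMap R hR) :=
  surjective_wallmanMap hR fun b h =>
    incl_eq_top R b (basicSet_eq_univ_iff.1 (congrArg SetLike.coe h))

/-- Closed subfitness replaces a `q ∈ P` outside `F` that completes `a` by an element of `R` below
`q`. Only the direction from right to left needs it. -/
theorem mem_restrictMap {R : BddSublattice P} {hR : IsNormalLat R} (hi : IsClosedSubfit R.incl)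
    {F : W P} {a : R} : a ∈ (restrictMap R hR F).1 ↔ (a : P) ∈ F.1 := by
  refine ⟨fun h => mem_of_mem_wallmanPoint (hL := hR) h, fun h => ?_⟩
  obtain ⟨q, hq, haq⟩ := exists_notMem_sup_eq_top_of_mem F h
  obtain ⟨p, hp, hpq⟩ := hi a q haq
  exact mem_wallmanMap.2 ⟨p, fun h => hq (F.mono hpq h), hp⟩

theorem comap_basicHom_injective {L : Type u} [DistribLattice L] [BoundedOrder L]
    (hL : IsSubfit L) {Y : Type*} [TopologicalSpace Y] {h : C(Y, W L)}
    (hh : Function.Surjective h) {a b : L}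
    (hab : Opens.comap h (basicHom L a) = Opens.comap h (basicHom L b)) : a = b :=
  hL.basicSet_injective (hh.preimage_injective (congrArg SetLike.coe hab))

theorem exists_sup_eq_top_of_comap {L : Type u} [DistribLattice L] [BoundedOrder L]
    (hL : IsNormalLat L) {Y : Type*} [TopologicalSpace Y] [CompactSpace Y] (h : C(Y, W L))
    {a : L} {V : Opens Y} (haV : Opens.comap h (basicHom L a) ⊔ V = ⊤) :
    ∃ b, a ⊔ b = ⊤ ∧ Opens.comap h (basicHom L b) ≤ V := by
  classical
  have := hL.t2Space
  have hC : IsClosed (h '' ((V : Set Y)ᶜ)) :=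
    (V.isOpen.isClosed_compl.isCompact.image h.continuous).isClosed
  -- The basic set of `a` covers the closed image of the complement of `V`, and basic sets missing
  -- that image cover the rest. The join of finitely many of the latter is the required `b`.
  obtain ⟨B, hB, hBtop⟩ := exists_finset_of_cover
    (insert a {b : L | basicSet b ⊆ (h '' ((V : Set Y)ᶜ))ᶜ}) fun F => by
      by_cases hF : F ∈ h '' ((V : Set Y)ᶜ)
      · obtain ⟨y, hy, rfl⟩ := hF
        have hy' : y ∈ Opens.comap h (basicHom L a) ⊔ V := haV ▸ trivial
        exact ⟨a, Or.inl rfl, hy'.resolve_right hy⟩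
      · obtain ⟨_, ⟨b, rfl⟩, hbF, hb⟩ :=
          isTopologicalBasis_basicSet.exists_subset_of_mem_open hF hC.isOpen_compl
        exact ⟨b, Or.inr hb, hbF⟩
  refine ⟨(B.erase a).sup id, ?_, fun y hy => ?_⟩
  · refine top_le_iff.1 (hBtop.symm.le.trans (Finset.sup_le fun b hb => ?_))
    by_cases hba : b = a
    · exact hba ▸ le_sup_left
    · exact le_sup_of_le_right (Finset.le_sup (f := id) (Finset.mem_erase.2 ⟨hba, hb⟩))
  · obtain ⟨b, hb, hby⟩ := ((h y).finset_sup_mem _).1 hy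
    obtain ⟨hba, hb⟩ := Finset.mem_erase.1 hb
    by_contra hyV
    exact (hB hb).resolve_left hba hby ⟨y, hyV, rfl⟩

end NormalSublattice

end WallmanDuality

/-! ### The largest normal sublattice -/

theorem mainTheorem2 (P : Type u) [DistribLattice P] [BoundedOrder P]
    (hcomplete : IsCompleteLat P) (hcompact : IsCompactLat P) (hsubfit : IsSubfit P) :
    ∃ (S : BddSublattice P) (f : C(W P, W (cozeroLattice (W P))))
      (e : Opens (W (cozeroLattice (W P))) ≃o S),
      -- `S` is normal, complete, compact and subfit, with closed subfit inclusion
      (IsNormalLat S ∧ IsCompleteLat S ∧ IsCompactLat S ∧ IsSubfit S ∧ IsClosedSubfit S.incl) ∧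
      -- `S` contains every normal sublattice whose inclusion is closed subfit
      (∀ R : BddSublattice P, IsNormalLat R → IsClosedSubfit R.incl →
        R.toSublattice ≤ S.toSublattice) ∧
      -- every normal subfit sublattice embeds into `S`
      (∀ R : BddSublattice P, IsNormalLat R → IsSubfit R →
        ∃ j : BoundedLatticeHom R S, Function.Injective j ∧ IsClosedSubfit j) ∧
      -- `f` is the canonical map to the minimal prime filters of cozero sets
      (∀ (F : W P) (U : cozeroLattice (W P)),
        U ∈ (f F).1 ↔ F ∈ U.1 ∧ ∃ V : cozeroLattice (W P), F ∉ V.1 ∧ U ⊔ V = ⊤) ∧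
      -- `f` is the weak Stone–Čech compactification of `W(P)`
      IsWeakStoneCech.{u, v} f ∧
      -- `S` is the dual of this compactification, embedded in `P` by taking preimages along `f`
      (∀ V : Opens (W (cozeroLattice (W P))),
        f ⁻¹' (V : Set (W (cozeroLattice (W P)))) = basicSet (e V : P)) := by
  let E := opensIso hcomplete hcompact hsubfit
  have hQ := isNormalLat_cozeroLattice (X := W P)
  have : T2Space (W (cozeroLattice (W P))) := hQ.t2Space
  have hf : Function.Surjective (cozeroMap (W P)) := surjective_cozeroMap
  let e := pullbackIso E hf
  refine ⟨pullbackSublattice E (cozeroMap (W P)), cozeroMap (W P), e,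
    ⟨isNormalLat_of_opens_orderIso e, isCompleteLat_of_orderIso e,
      isCompactLat_of_opens_orderIso e, isSubfit_of_opens_orderIso e,
      isClosedSubfit_incl_pullbackSublattice E _⟩, ?_, ?_, ?_, isWeakStoneCech_cozeroMap, ?_⟩
  · intro R hR hi p hp
    have := hR.t2Space
    obtain ⟨h, hh⟩ := exists_comp_cozeroMap_eq (restrictMap R hR)
    refine ⟨Opens.comap h (basicHom R ⟨p, hp⟩), Opens.ext (Set.ext fun F => ?_)⟩
    have hF : h (cozeroMap (W P) F) = restrictMap R hR F :=
      congrArg (fun k : C(W P, W R) => k F) hh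
    change p ∈ F.1 ↔ (⟨p, hp⟩ : R) ∈ (h (cozeroMap (W P) F)).1
    rw [hF, mem_restrictMap hi]
  · intro R hR hRs
    have := hR.t2Space
    obtain ⟨h, hh⟩ := exists_comp_cozeroMap_eq (restrictMap R hR)
    have hsurj : Function.Surjective h := by
      refine Function.Surjective.of_comp (g := cozeroMap (W P)) ?_
      rw [← ContinuousMap.coe_comp, hh]
      exact surjective_restrictMap R hR
    -- The element `a` goes to the preimage of its basic set in `W R`, which need not be `a` itself.
    let j : BoundedLatticeHom R (pullbackSublattice E (cozeroMap (W P))) :=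
      { toFun := fun a => e (Opens.comap h (basicHom R a))
        map_sup' := fun a b => by rw [map_sup, map_sup, map_sup]
        map_inf' := fun a b => by rw [map_inf, map_inf, map_inf]
        map_top' := by rw [map_top, map_top, map_top]
        map_bot' := by rw [map_bot, map_bot, map_bot] }
    refine ⟨j, fun a b hab => comap_basicHom_injective hRs hsurj (e.injective hab), ?_⟩
    intro a q haq
    have haq : e (Opens.comap h (basicHom R a)) ⊔ q = ⊤ := haq
    have hV : Opens.comap h (basicHom R a) ⊔ e.symm q = ⊤ := by
      apply e.injective
      rw [map_sup, e.apply_symm_apply, haq, map_top]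
    obtain ⟨b, hab, hb⟩ := exists_sup_eq_top_of_comap hR h hV
    exact ⟨b, hab, e.le_symm_apply.1 hb⟩
  · intro F U
    exact ⟨fun h => ⟨mem_of_mem_cozeroMap h, mem_cozeroMap.1 h⟩, fun h => mem_cozeroMap.2 h.2⟩
  · intro V
    exact (congrArg SetLike.coe (apply_pullbackIso E hf V)).symm
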